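/- Let $l \ge 1$ and $n \ge 3$ be integers, let $k, \beta \in \mathbb{C}$, and put $N = ln$ and $\alpha = k + (l-1)n$. Let $\hat{\mathfrak{gl}}_n = \mathfrak{gl}_n[t,t^{-1}] \oplus \mathbb{C}\mathbf{1}$ be the affine Lie algebra with $\mathbf{1}$ central and $$[X(m), Y(m')] = [X,Y](m+m') + m\,\delta_{m+m',0}\,\bigl(\alpha\,\mathrm{tr}(XY) + \mathrm{tr}(X)\,\mathrm{tr}(Y)\bigr)\mathbf{1}, \qquad X(m) = Xt^m,$$ and let $U(\hat{\mathfrak{gl}}_n^{\alpha})$ be the quotient of its universal enveloping algebra by $\mathbf{1} = 1$. Let $A = U(\hat{\mathfrak{gl}}_n^{\alpha})^{\otimes l}$, graded by $\deg X^{[s]}(m) = m$, where $X^{[s]}$ denotes $X$ placed in the $s$-th tensor factor, and let $$U(\hat{\mathfrak{gl}}_n^{\alpha})_{\mathrm{comp}}^{\otimes l} = \bigoplus_{d \in \mathbb{Z}} \varprojlim_m \Bigl( A_d \Big/ \sum_{r > m} A_{d-r} A_r \Bigr).$$ This algebra is the current algebra of the vertex algebra $V^{\tilde\kappa}(\mathfrak{gl}_n)^{\otimes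 l}$, where $V^{\tilde\kappa}(\mathfrak{gl}_n)$ is the universal affine vertex algebra for the bilinear form $\tilde\kappa(X,Y) = \alpha\,\mathrm{tr}(XY) + \mathrm{tr}(X)\,\mathrm{tr}(Y)$. For $X \in \mathfrak{gl}_n$ and $p \ge 1$ write $X^{[s]}[-p]$ for the state $X^{[s]}(-p)|0\rangle$. Let $A^{[s]}$ be the $n \times n$ matrix with entries the operators $E^{[s]}_{i,j}[-1]_{(-1)}$ on $V^{\tilde\kappa}(\mathfrak{gl}_n)^{\otimes l}$, let $\tau$ be a formal operator with $[X^{[s]}[-p], \tau] = \alpha p X^{[s]}[-p-1]$, and define elements $W^{(r)}_{i,j}$ of $V^{\tilde\kappa}(\mathfrak{gl}_n)^{\otimes l}$ as the entries of the matrices $W^{(r)}$ in $$(\tau + A^{[1]})(\tau + A^{[2]}) \cdots (\tau + A^{[l]}) = \tau^l + \sum_{r=1}^{l} \tau^{l-r} W^{(r)},$$ the right-most factor $X[-p]_{(-1)}$ of each monomial being read as the state $X[-p]$. The rectangular $W$-algebra $\mathcal{W}^{\kappa}(\mathfrak{g},f)$, with $\mathfrak{g} = \mathfrak{gl}_N$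 and $f$ nilpotent of Jordan type $(l^n)$ at level $k$, is regarded through the Miura map as the vertex subalgebra of $V^{\tilde\kappa}(\mathfrak{gl}_n)^{\otimes l}$ generated by the $W^{(r)}_{i,j}$ ($1 \le r \le l$, $1 \le i,j \le n$). Its current algebra $\mathfrak{U}(\mathcal{W}^{\kappa}(\mathfrak{g},f))$ is regarded as the closed subalgebra of $U(\hat{\mathfrak{gl}}_n^{\alpha})_{\mathrm{comp}}^{\otimes l}$ topologically generated by the Fourier coefficients $vt^m$ ($v \in \mathcal{W}^{\kappa}(\mathfrak{g},f)$, $m \in \mathbb{Z}$). Let $\eta_\beta$ be the algebra automorphism of $U(\hat{\mathfrak{gl}}_n^{\alpha})$ with $\eta_\beta(E_{i,j}(m)) = E_{i,j}(m) + \delta_{m,0}\delta_{i,j}\beta$, and let $\eta_\beta^{\otimes l}$ be the induced automorphism of $U(\hat{\mathfrak{gl}}_n^{\alpha})_{\mathrm{comp}}^{\otimes l}$. Then $\eta_\beta^{\otimes l}$ preserves $\mathfrak{U}(\mathcal{W}^{\kappa}(\mathfrak{g},f))$, that is, $$\eta_\beta^{\otimes l}\bigl(\mathfrak{U}(\mathcal{W}^{\kappa}(\mathfrak{g},f))\bigr)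 = \mathfrak{U}(\mathcal{W}^{\kappa}(\mathfrak{g},f)).$$ -/

import Mathlib

noncomputable section

open scoped TensorProduct

namespace RectangularW

section AffineLie

attribute [local instance] LieRing.ofAssociativeRing

/-- The complex Lie algebra `𝔤𝔩ₙ` of `n × n` matrices with the commutator bracket. -/
def GlLie (n : ℕ) : Type := Matrix (Fin n) (Fin n) ℂ

instance (n : ℕ) : AddCommGroup (GlLie n) := inferInstanceAs (AddCommGroup (Matrix (Fin n) (Fin n) ℂ))
instance (n : ℕ) : Module ℂ (GlLie n) := inferInstanceAs (Module ℂ (Matrix (Fin n) (Fin n) ℂ))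
instance (n : ℕ) : LieRing (GlLie n) := inferInstanceAs (LieRing (Matrix (Fin n) (Fin n) ℂ))
instance (n : ℕ) : LieAlgebra ℂ (GlLie n) :=
  inferInstanceAs (LieAlgebra ℂ (Matrix (Fin n) (Fin n) ℂ))

/-- The matrix underlying an element of `𝔤𝔩ₙ`. -/
def GlLie.toMat {n : ℕ} : GlLie n ≃ₗ[ℂ] Matrix (Fin n) (Fin n) ℂ := LinearEquiv.refl ℂ _

theorem GlLie.toMat_lie {n : ℕ} (X Y : GlLie n) :
    GlLie.toMat ⁅X, Y⁆ = GlLie.toMat X * GlLie.toMat Y - GlLie.toMat Y * GlLie.toMat X := rfl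

end AffineLie

/-- The matrix unit `E_{i,j}`. -/
def GlLie.E {n : ℕ} (i j : Fin n) : GlLie n := GlLie.toMat.symm (Matrix.single i j 1)

/-- The invariant symmetric bilinear form `(X, Y) = α tr(XY) + tr(X) tr(Y)` on `𝔤𝔩ₙ`, that is
`(E_{i,j}, E_{p,q}) = δ_{iq} δ_{jp} α + δ_{ij} δ_{pq}`: it is `α tr(XY)` on `𝔰𝔩ₙ`, `(α + n) tr(XY)`
on the scalar matrices, and the two are orthogonal. -/
def form (n : ℕ) (α : ℂ) : LinearMap.BilinForm ℂ (GlLie n) :=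
  LinearMap.mk₂ ℂ
    (fun X Y => α * (GlLie.toMat X * GlLie.toMat Y).trace + (GlLie.toMat X).trace * (GlLie.toMat Y).trace)
    (by intros; simp [add_mul]; ring) (by intros; simp; ring)
    (by intros; simp [mul_add]; ring) (by intros; simp; ring)

theorem form_apply (n : ℕ) (α : ℂ) (X Y : GlLie n) : form n α X Y =
    α * (GlLie.toMat X * GlLie.toMat Y).trace + (GlLie.toMat X).trace * (GlLie.toMat Y).trace := rfl

theorem form_isSymm (n : ℕ) (α : ℂ) : (form n α).IsSymm :=
  ⟨fun X Y => by
    simp [form_apply, Matrix.trace_mul_comm (GlLie.toMat X), mul_comm (GlLie.toMat X).trace]⟩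

theorem form_lieInvariant (n : ℕ) (α : ℂ) : (form n α).lieInvariant (GlLie n) := by
  intro X Y Z
  have h := Matrix.trace_mul_cycle (GlLie.toMat Y) (GlLie.toMat X) (GlLie.toMat Z)
  have h' := Matrix.trace_mul_cycle (GlLie.toMat Y) (GlLie.toMat Z) (GlLie.toMat X)
  simp only [form_apply, GlLie.toMat_lie, Matrix.trace_sub, sub_mul, mul_sub, ← mul_assoc, h, h',
    Matrix.trace_mul_comm (GlLie.toMat X) (GlLie.toMat Y), Matrix.trace_mul_comm (GlLie.toMat X) (GlLie.toMat Z)]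
  ring

/-- The 2-cocycle `(X t^m, Y t^m') ↦ m δ_{m+m',0} (X, Y)` on the loop algebra `𝔤𝔩ₙ[t, t⁻¹]`.
Mathlib's `twoCocycleOfBilinear` is `(f, g) ↦ Res f dg`, which has the opposite sign; see
`AffineGl.lie_cur` for the resulting bracket. -/
def cocycle (n : ℕ) (α : ℂ) : LieModule.Cohomology.twoCocycle ℂ (LieAlgebra.loopAlgebra ℂ ℤ (GlLie n))
    (TrivialLieModule ℂ (LieAlgebra.loopAlgebra ℂ ℤ (GlLie n)) ℂ) :=
  (-1 : ℂ) • LieAlgebra.LoopAlgebra.twoCocycleOfBilinear ℂ ℤ (GlLie n) (form n α) (form_lieInvariant n α)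
      (form_isSymm n α)

/-- The affine Lie algebra `𝔤𝔩ₙ[t, t⁻¹] ⊕ ℂ 𝟏`. -/
abbrev AffineGl (n : ℕ) (α : ℂ) : Type := LieAlgebra.ofTwoCocycle (cocycle n α)

/-- The element `X t^m` of the loop algebra. -/
def loopElt {n : ℕ} (X : GlLie n) (m : ℤ) : LieAlgebra.loopAlgebra ℂ ℤ (GlLie n) :=
  AddMonoidAlgebra.single m 1 ⊗ₜ X

/-- The element `X(m) = X t^m` of the affine Lie algebra. -/
def AffineGl.cur {n : ℕ} (α : ℂ) (X : GlLie n) (m : ℤ) : AffineGl n α :=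
  LieAlgebra.ofProd (cocycle n α) (loopElt X m, 0)

/-- The central element `𝟏`. -/
def AffineGl.one (n : ℕ) (α : ℂ) : AffineGl n α :=
  LieAlgebra.ofProd (cocycle n α) (0, (TrivialLieModule.equiv ℂ _ ℂ).symm 1)


theorem AffineGl.lie_cur {n : ℕ} (α : ℂ) (X Y : GlLie n) (m m' : ℤ) :
    ⁅AffineGl.cur α X m, AffineGl.cur α Y m'⁆ = AffineGl.cur α ⁅X, Y⁆ (m + m') +
      (if m + m' = 0 then (m : ℂ) * form n α X Y else 0) • AffineGl.one n α := by
  have h : (cocycle n α).1.1 (loopElt X m) (loopElt Y m') = (TrivialLieModule.equiv ℂ _ ℂ).symm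
        (if m + m' = 0 then (m : ℂ) * form n α X Y else 0) := by
    change (-1 : ℂ) • (TrivialLieModule.equiv ℂ _ ℂ).symm
      (LieAlgebra.LoopAlgebra.residuePairing ℂ ℤ (GlLie n) (form n α) (loopElt X m) (loopElt Y m'))
      = _
    rw [← map_smul]
    congr 1
    simp only [LieAlgebra.LoopAlgebra.residuePairing_apply_apply, loopElt,
      LieAlgebra.LoopAlgebra.toFinsupp_single_tmul]
    rw [Finsupp.sum_single_index (by simp)]
    by_cases hm : m + m' = 0
    · obtain rfl : m' = -m := by lia
      simp
    · rw [Finsupp.single_eq_of_ne (by lia)]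
      simp [hm]
  rw [LieAlgebra.bracket_ofTwoCocycle]
  simp only [AffineGl.cur, Equiv.symm_apply_apply, lie_zero, sub_zero, add_zero, AffineGl.one,
    ← LieAlgebra.of_smul, ← LieAlgebra.of_add]
  congr 1
  refine Prod.ext ?_ ?_
  · simp only [Prod.fst_add, Prod.smul_fst, smul_zero, add_zero, loopElt]
    rw [LieAlgebra.ExtendScalars.bracket_tmul, AddMonoidAlgebra.single_mul_single, one_mul]
  · simp only [Prod.snd_add, Prod.smul_snd, zero_add]
    rw [← map_smul, smul_eq_mul, mul_one]
    exact h

theorem AffineGl.lie_one {n : ℕ} (α : ℂ) (x : AffineGl n α) : ⁅AffineGl.one n α, x⁆ = 0 := by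
  rw [LieAlgebra.bracket_ofTwoCocycle]
  simp only [AffineGl.one, Equiv.symm_apply_apply, zero_lie, map_zero, LinearMap.zero_apply,
    LieModule.IsTrivial.trivial, sub_zero, add_zero]
  rfl

/-- The linear functional `X t^m ↦ δ_{m,0} tr X`, `𝟏 ↦ 0`. -/
def AffineGl.traceZero (n : ℕ) (α : ℂ) : AffineGl n α →ₗ[ℂ] ℂ where
  toFun x := (GlLie.toMat
    (LieAlgebra.LoopAlgebra.toFinsupp ℂ ℤ (GlLie n) ((LieAlgebra.ofProd _).symm x).1 0)).trace
  map_add' x y := by simp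
  map_smul' c x := by simp

theorem AffineGl.traceZero_cur {n : ℕ} (α : ℂ) (X : GlLie n) (m : ℤ) :
    AffineGl.traceZero n α (AffineGl.cur α X m) = if m = 0 then (GlLie.toMat X).trace else 0 := by
  simp only [traceZero, cur, loopElt, LinearMap.coe_mk, AddHom.coe_mk, Equiv.symm_apply_apply,
    LieAlgebra.LoopAlgebra.toFinsupp_single_tmul]
  split_ifs with h
  · simp [h]
  · rw [Finsupp.single_eq_of_ne (by lia)]; simp

theorem AffineGl.traceZero_one (n : ℕ) (α : ℂ) :
    AffineGl.traceZero n α (AffineGl.one n α) = 0 := by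
  simp [traceZero, one]

theorem AffineGl.traceZero_lie {n : ℕ} (α : ℂ) (x y : AffineGl n α) :
    AffineGl.traceZero n α ⁅x, y⁆ = 0 := by
  rw [LieAlgebra.bracket_ofTwoCocycle]
  simp only [traceZero, LinearMap.coe_mk, AddHom.coe_mk, Equiv.symm_apply_apply]
  generalize ((LieAlgebra.ofProd (cocycle n α)).symm x).1 = f
  generalize ((LieAlgebra.ofProd (cocycle n α)).symm y).1 = g
  induction f using TensorProduct.induction_on with
  | zero => simp
  | add f₁ f₂ h₁ h₂ => simp [h₁, h₂]
  | tmul p X =>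
    induction g using TensorProduct.induction_on with
    | zero => simp
    | add f₁ f₂ h₁ h₂ => simp [h₁, h₂]
    | tmul q Y =>
      rw [LieAlgebra.ExtendScalars.bracket_tmul]
      generalize p * q = r
      induction r using AddMonoidAlgebra.induction_linear with
      | zero => simp
      | add f₁ f₂ h₁ h₂ => simp [TensorProduct.add_tmul, h₁, h₂]
      | single a c =>
        have : (AddMonoidAlgebra.single a c : AddMonoidAlgebra ℂ ℤ) = c • AddMonoidAlgebra.single a 1 := by
          rw [AddMonoidAlgebra.smul_single, smul_eq_mul, mul_one]
        rw [this, ← TensorProduct.smul_tmul', map_smul, LieAlgebra.LoopAlgebra.toFinsupp_single_tmul]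
        by_cases h : a = 0
        · subst h
          simp [GlLie.toMat_lie, Matrix.trace_mul_comm (GlLie.toMat X)]
        · simp [Finsupp.single_eq_of_ne (Ne.symm h)]

/-- The relation `𝟏 = 1` in the universal enveloping algebra. -/
inductive LevelRel (n : ℕ) (α : ℂ) : UniversalEnvelopingAlgebra ℂ (AffineGl n α) →
    UniversalEnvelopingAlgebra ℂ (AffineGl n α) → Prop
  | one : LevelRel n α (UniversalEnvelopingAlgebra.ι ℂ (AffineGl.one n α)) 1

/-- `U(𝔤𝔩̂ₙ^α)`: the universal enveloping algebra of the affine Lie algebra modulo `𝟏 = 1`. -/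
def UAff (n : ℕ) (α : ℂ) : Type := RingQuot (LevelRel n α)

instance (n : ℕ) (α : ℂ) : Ring (UAff n α) := inferInstanceAs (Ring (RingQuot (LevelRel n α)))
instance (n : ℕ) (α : ℂ) : Algebra ℂ (UAff n α) :=
  inferInstanceAs (Algebra ℂ (RingQuot (LevelRel n α)))

/-- The quotient map. -/
def UAff.mk (n : ℕ) (α : ℂ) : UniversalEnvelopingAlgebra ℂ (AffineGl n α) →ₐ[ℂ] UAff n α :=
  RingQuot.mkAlgHom ℂ (LevelRel n α)

/-- The image of an element of the affine Lie algebra. -/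
def UAff.ι {n : ℕ} {α : ℂ} (x : AffineGl n α) : UAff n α :=
  UAff.mk n α (UniversalEnvelopingAlgebra.ι ℂ x)

theorem UAff.ι_one (n : ℕ) (α : ℂ) : UAff.ι (AffineGl.one n α) = 1 := by
  have := RingQuot.mkAlgHom_rel ℂ (LevelRel.one (n := n) (α := α))
  exact this.trans (map_one _)

/-- The element `X(m)` of `U(𝔤𝔩̂ₙ^α)`. -/
def UAff.cur {n : ℕ} (α : ℂ) (X : GlLie n) (m : ℤ) : UAff n α := UAff.ι (AffineGl.cur α X m)

section
attribute [local instance] LieRing.ofAssociativeRing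

/-- `UAff.ι` as a Lie algebra homomorphism. -/
def UAff.ιLie (n : ℕ) (α : ℂ) : AffineGl n α →ₗ⁅ℂ⁆ UAff n α :=
  LieHom.comp (AlgHom.toLieHom (UAff.mk n α)) (UniversalEnvelopingAlgebra.ι ℂ)

theorem UAff.cur_comm {n : ℕ} (α : ℂ) (X Y : GlLie n) (m m' : ℤ) :
    UAff.cur α X m * UAff.cur α Y m' - UAff.cur α Y m' * UAff.cur α X m =
      UAff.cur α ⁅X, Y⁆ (m + m') +
      algebraMap ℂ _ (if m + m' = 0 then (m : ℂ) * form n α X Y else 0) := by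
  have h := congrArg (UAff.ιLie n α) (AffineGl.lie_cur α X Y m m')
  rw [LieHom.map_lie, map_add, map_smul] at h
  rw [Algebra.algebraMap_eq_smul_one, ← UAff.ι_one]
  exact h

/-- The Lie algebra homomorphism `X(m) ↦ X(m) + δ_{m,0} β tr X`. -/
def UAff.etaLie (n : ℕ) (α β : ℂ) : AffineGl n α →ₗ⁅ℂ⁆ UAff n α :=
  { (UAff.ιLie n α : AffineGl n α →ₗ[ℂ] UAff n α) +
      (β • AffineGl.traceZero n α).smulRight (1 : UAff n α) with
    map_lie' := by
      intro x y
      have h := (UAff.ιLie n α).map_lie x y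
      simp only [LieRing.of_associative_ring_bracket] at h
      simp [AffineGl.traceZero_lie, h, LieRing.of_associative_ring_bracket, add_mul, mul_add,
        smul_smul, mul_comm (β * AffineGl.traceZero n α y)]
      abel }

theorem UAff.etaLie_apply {n : ℕ} {α : ℂ} (β : ℂ) (x : AffineGl n α) : UAff.etaLie n α β x =
    UAff.ι x + (β * AffineGl.traceZero n α x) • (1 : UAff n α) := rfl

/-- The algebra endomorphism `X(m) ↦ X(m) + δ_{m,0} β tr X` of `U(𝔤𝔩̂ₙ^α)`. -/
def UAff.etaHom (n : ℕ) (α β : ℂ) : UAff n α →ₐ[ℂ] UAff n α :=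
  RingQuot.liftAlgHom ℂ ⟨UniversalEnvelopingAlgebra.lift ℂ (UAff.etaLie n α β), by
    rintro _ _ ⟨⟩
    rw [UniversalEnvelopingAlgebra.lift_ι_apply, map_one]
    rw [UAff.etaLie_apply, AffineGl.traceZero_one, UAff.ι_one, mul_zero, zero_smul, add_zero]⟩

theorem UAff.etaHom_ι {n : ℕ} {α : ℂ} (β : ℂ) (x : AffineGl n α) : UAff.etaHom n α β (UAff.ι x) =
    UAff.ι x + algebraMap ℂ _ (β * AffineGl.traceZero n α x) := by
  unfold etaHom UAff.ι UAff.mk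
  erw [RingQuot.liftAlgHom_mkAlgHom_apply, UniversalEnvelopingAlgebra.lift_ι_apply]
  rw [Algebra.algebraMap_eq_smul_one]
  rfl

theorem UAff.hom_ext {n : ℕ} {α : ℂ} {B : Type*} [Ring B] [Algebra ℂ B] {f g : UAff n α →ₐ[ℂ] B}
    (h : ∀ x, f (UAff.ι x) = g (UAff.ι x)) : f = g := by
  apply RingQuot.ringQuot_ext'
  apply UniversalEnvelopingAlgebra.hom_ext
  ext x
  exact h x

end

theorem UAff.etaHom_comp {n : ℕ} {α : ℂ} (β γ : ℂ) :
    (UAff.etaHom n α β).comp (UAff.etaHom n α γ) = UAff.etaHom n α (β + γ) := by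
  apply UAff.hom_ext
  intro x
  simp [UAff.etaHom_ι, add_mul, add_assoc]
  
theorem UAff.etaHom_zero {n : ℕ} {α : ℂ} : UAff.etaHom n α 0 = AlgHom.id ℂ _ := by
  apply UAff.hom_ext
  intro x
  simp [UAff.etaHom_ι]

/-- The algebra automorphism `η_β` of `U(𝔤𝔩̂ₙ^α)`, determined by
`E_{i,j}(m) ↦ E_{i,j}(m) + δ_{m,0} δ_{i,j} β` (see `UAff.eta_cur_E`). -/
def UAff.eta (n : ℕ) (α β : ℂ) : UAff n α ≃ₐ[ℂ] UAff n α :=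
  AlgEquiv.ofAlgHom (UAff.etaHom n α β) (UAff.etaHom n α (-β))
    (by rw [UAff.etaHom_comp, add_neg_cancel, UAff.etaHom_zero])
    (by rw [UAff.etaHom_comp, neg_add_cancel, UAff.etaHom_zero])

theorem UAff.eta_cur_E {n : ℕ} (α β : ℂ) (i j : Fin n) (m : ℤ) :
    UAff.eta n α β (UAff.cur α (GlLie.E i j) m) =
      UAff.cur α (GlLie.E i j) m + algebraMap ℂ _ (if m = 0 ∧ i = j then β else 0) := by
  change UAff.etaHom n α β (UAff.ι _) = _
  rw [UAff.etaHom_ι, AffineGl.traceZero_cur]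
  congr 2
  by_cases hm : m = 0 <;> by_cases hij : i = j <;>
    simp [hm, hij, GlLie.E, Matrix.trace_single_eq_of_ne]

/-- The algebra `U(𝔤𝔩̂ₙ^α)^{⊗ l}`. -/
abbrev UTensor (l n : ℕ) (α : ℂ) : Type := ⨂[ℂ] _ : Fin l, UAff n α

/-- `X ↦ X^{[s]} = 1 ⊗ ⋯ ⊗ X ⊗ ⋯ ⊗ 1`, with `X` in the `s`-th place. -/
def UTensor.single {l n : ℕ} {α : ℂ} (s : Fin l) : UAff n α →ₐ[ℂ] UTensor l n α :=
  PiTensorProduct.singleAlgHom (R := ℂ) (A := fun _ : Fin l => UAff n α) s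

/-- The element `X^{[s]}(m)` of `U(𝔤𝔩̂ₙ^α)^{⊗ l}`. -/
def UTensor.cur {l n : ℕ} (α : ℂ) (s : Fin l) (X : GlLie n) (m : ℤ) : UTensor l n α :=
  UTensor.single s (UAff.cur α X m)

theorem UTensor.hom_ext {l n : ℕ} {α : ℂ} {B : Type*} [Ring B] [Algebra ℂ B]
    {f g : UTensor l n α →ₐ[ℂ] B}
    (h : ∀ s x, f (UTensor.single s (UAff.ι x)) = g (UTensor.single s (UAff.ι x))) : f = g := by
  apply PiTensorProduct.algHom_ext
  intro s
  apply UAff.hom_ext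
  intro x
  exact h s x

/-- `φ^{⊗ l}` for an algebra endomorphism `φ`. -/
def UTensor.map {l n : ℕ} {α : ℂ} (φ : UAff n α →ₐ[ℂ] UAff n α) : UTensor l n α →ₐ[ℂ] UTensor l n α :=
  PiTensorProduct.liftAlgHom
    ((PiTensorProduct.tprod ℂ).compLinearMap fun _ : Fin l => φ.toLinearMap)
    (by simp [PiTensorProduct.one_def]; rfl)
    (by intro x y; simp; rfl)

theorem UTensor.map_tprod {l n : ℕ} {α : ℂ} (φ : UAff n α →ₐ[ℂ] UAff n α) (x : Fin l → UAff n α) :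
    UTensor.map φ (PiTensorProduct.tprod ℂ x) = PiTensorProduct.tprod ℂ fun s => φ (x s) := by
  simp [UTensor.map]

theorem UTensor.map_single {l n : ℕ} {α : ℂ} (φ : UAff n α →ₐ[ℂ] UAff n α) (s : Fin l)
    (x : UAff n α) : UTensor.map φ (UTensor.single s x) = UTensor.single s (φ x) := by
  simp only [single, PiTensorProduct.singleAlgHom_apply, map_tprod]
  congr 1
  ext t
  by_cases h : t = s
  · subst h; simp
  · simp [h]

/-- The algebra automorphism `η_β^{⊗ l}` of `U(𝔤𝔩̂ₙ^α)^{⊗ l}`. -/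
def UTensor.eta (l n : ℕ) (α β : ℂ) : UTensor l n α ≃ₐ[ℂ] UTensor l n α :=
  AlgEquiv.ofAlgHom (UTensor.map (UAff.eta n α β).toAlgHom) (UTensor.map (UAff.eta n α β).symm.toAlgHom)
    (by apply UTensor.hom_ext; intro s x; simp [UTensor.map_single])
    (by apply UTensor.hom_ext; intro s x; simp [UTensor.map_single])

theorem UTensor.eta_single {l n : ℕ} (α β : ℂ) (s : Fin l) (x : UAff n α) :
    UTensor.eta l n α β (UTensor.single s x) = UTensor.single s (UAff.eta n α β x) :=
  UTensor.map_single _ s x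

/-- The degree `d` component of `A = U(𝔤𝔩̂ₙ^α)^{⊗ l}` for the grading with `deg X^{[s]}(m) = m`: the
span of the monomials in the `X^{[s]}(m)` of total degree `d`. -/
def UTensor.homog (l n : ℕ) (α : ℂ) (d : ℤ) : Submodule ℂ (UTensor l n α) :=
  Submodule.span ℂ {x | ∃ L : List (Fin l × GlLie n × ℤ), (L.map fun p => p.2.2).sum = d ∧
    x = (L.map fun p => UTensor.cur α p.1 p.2.1 p.2.2).prod}

theorem UTensor.one_mem_homog {l n : ℕ} {α : ℂ} : (1 : UTensor l n α) ∈ homog l n α 0 :=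
  Submodule.subset_span ⟨[], by simp, by simp⟩

theorem UTensor.cur_mem_homog {l n : ℕ} {α : ℂ} (s : Fin l) (X : GlLie n) (m : ℤ) :
    UTensor.cur α s X m ∈ homog l n α m :=
  Submodule.subset_span ⟨[(s, X, m)], by simp, by simp⟩

theorem UTensor.mul_mem_homog {l n : ℕ} {α : ℂ} {d e : ℤ} {x y : UTensor l n α}
    (hx : x ∈ homog l n α d) (hy : y ∈ homog l n α e) : x * y ∈ homog l n α (d + e) := by
  have h := Submodule.mul_mem_mul hx hy
  rw [homog, homog, Submodule.span_mul_span] at h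
  refine Submodule.span_mono ?_ h
  rintro _ ⟨_, ⟨L, hL, rfl⟩, _, ⟨M, hM, rfl⟩, rfl⟩
  exact ⟨L ++ M, by simp [hL, hM], by simp⟩

theorem AffineGl.span_cur (n : ℕ) (α : ℂ) (x : AffineGl n α) :
    x ∈ Submodule.span ℂ (insert (AffineGl.one n α)
      {y | ∃ X m, y = AffineGl.cur α X m}) := by
  have h0 : ∀ f, LieAlgebra.ofProd (cocycle n α) (f, 0) ∈
      Submodule.span ℂ {y | ∃ X m, y = AffineGl.cur α X m} := by
    intro f
    have hadd : ∀ f g, LieAlgebra.ofProd (cocycle n α) (f + g, 0) =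
        LieAlgebra.ofProd (cocycle n α) (f, 0) + LieAlgebra.ofProd (cocycle n α) (g, 0) := by
      intro f g
      rw [← LieAlgebra.of_add, Prod.mk_add_mk, add_zero]
    induction f using TensorProduct.induction_on with
    | zero => exact zero_mem _
    | add f g hf hg => rw [hadd]; exact add_mem hf hg
    | tmul p X =>
      induction p using AddMonoidAlgebra.induction_linear with
      | zero => rw [TensorProduct.zero_tmul]; exact zero_mem _
      | add f g hf hg => rw [TensorProduct.add_tmul, hadd]; exact add_mem hf hg
      | single a c =>
        refine Submodule.subset_span ⟨c • X, a, ?_⟩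
        rw [AffineGl.cur, loopElt, ← TensorProduct.smul_tmul, AddMonoidAlgebra.smul_single,
          smul_eq_mul, mul_one]
  obtain ⟨f, c⟩ := x
  have h1 : LieAlgebra.ofProd (cocycle n α) (f, c) = LieAlgebra.ofProd (cocycle n α) (f, 0) +
      (TrivialLieModule.equiv ℂ _ ℂ c) • AffineGl.one n α := by
    rw [AffineGl.one, ← LieAlgebra.of_smul, ← LieAlgebra.of_add]
    congr 1
    refine Prod.ext ?_ ?_
    · simp
    · simp only [Prod.snd_add, Prod.smul_snd, zero_add]
      rw [← map_smul, smul_eq_mul, mul_one, LinearEquiv.symm_apply_apply]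
  change LieAlgebra.ofProd (cocycle n α) (f, c) ∈ _
  rw [h1]
  exact add_mem (Submodule.span_mono (Set.subset_insert _ _) (h0 f))
    (Submodule.smul_mem _ _ (Submodule.subset_span (Set.mem_insert _ _)))

section
attribute [local instance] LieRing.ofAssociativeRing

theorem UAff.subalgebra_eq_top {n : ℕ} {α : ℂ} (S : Subalgebra ℂ (UAff n α))
    (h : ∀ X m, UAff.cur α X m ∈ S) : S = ⊤ := by
  have hι : ∀ x : AffineGl n α, UAff.ι x ∈ S := by
    intro x
    refine Submodule.span_induction (p := fun x _ => UAff.ι x ∈ S) ?_ ?_ ?_ ?_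
      (AffineGl.span_cur n α x)
    · rintro _ (rfl | ⟨X, m, rfl⟩)
      · rw [UAff.ι_one]; exact one_mem _
      · exact h X m
    · change UAff.ιLie n α 0 ∈ S
      rw [map_zero]; exact zero_mem S
    · intro x y _ _ hx hy
      change UAff.ιLie n α (x + y) ∈ S
      rw [map_add]; exact add_mem hx hy
    · intro c x _ hx
      change UAff.ιLie n α (c • x) ∈ S
      rw [map_smul]; exact S.smul_mem hx c
  let F : UniversalEnvelopingAlgebra ℂ (AffineGl n α) →ₐ[ℂ] S :=
    UniversalEnvelopingAlgebra.lift ℂ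
      { toFun := fun x => ⟨UAff.ι x, hι x⟩
        map_add' := fun x y => Subtype.ext (map_add (UAff.ιLie n α) x y)
        map_smul' := fun c x => Subtype.ext (map_smul (UAff.ιLie n α) c x)
        map_lie' := fun {x y} => Subtype.ext ((UAff.ιLie n α).map_lie x y) }
  have hF : S.val.comp F = UAff.mk n α := by
    apply UniversalEnvelopingAlgebra.hom_ext
    ext x
    change ((F (UniversalEnvelopingAlgebra.ι ℂ x) : S) : UAff n α) = UAff.ι x
    rw [UniversalEnvelopingAlgebra.lift_ι_apply]
    rfl
  rw [eq_top_iff]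
  intro x _
  obtain ⟨y, rfl⟩ := RingQuot.mkAlgHom_surjective ℂ (LevelRel n α) x
  change UAff.mk n α y ∈ S
  rw [← hF]
  exact (F y).2

end

theorem UTensor.subalgebra_eq_top {l n : ℕ} {α : ℂ} (S : Subalgebra ℂ (UTensor l n α))
    (h : ∀ s X m, UTensor.cur α s X m ∈ S) : S = ⊤ := by
  have h1 : ∀ s x, UTensor.single s x ∈ S := by
    intro s x
    have := UAff.subalgebra_eq_top (S.comap (UTensor.single s)) (fun X m => h s X m)
    exact (this ▸ Algebra.mem_top : x ∈ S.comap (UTensor.single s))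
  rw [eq_top_iff]
  intro x _
  induction x using PiTensorProduct.induction_on with
  | add x y hx hy => exact add_mem (hx trivial) (hy trivial)
  | smul_tprod r f =>
    refine S.smul_mem ?_ r
    have : ∀ t : Finset (Fin l),
        PiTensorProduct.tprod ℂ (fun i => if i ∈ t then f i else 1) ∈ S := by
      intro t
      induction t using Finset.induction_on with
      | empty =>
        simp only [Finset.notMem_empty, if_false]
        exact one_mem S
      | insert a t ha ih =>
        have := mul_mem (h1 a (f a)) ih
        convert this using 1
        simp only [single, PiTensorProduct.singleAlgHom_apply, PiTensorProduct.tprod_mul_tprod]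
        congr 1
        ext i
        by_cases hi : i = a
        · subst hi; simp [ha]
        · simp [hi]
    simpa using this Finset.univ

/-- The left ideal `∑_{r > m} A A_r`, whose degree `d` part is `∑_{r > m} A_{d-r} A_r`. -/
def UTensor.filt (l n : ℕ) (α : ℂ) (m : ℤ) : Ideal (UTensor l n α) :=
  Ideal.span {x | ∃ r, m < r ∧ x ∈ homog l n α r}

theorem UTensor.filt_anti {l n : ℕ} {α : ℂ} {m m' : ℤ} (h : m ≤ m') :
    filt l n α m' ≤ filt l n α m :=
  Ideal.span_mono fun _ ⟨r, hr, hx⟩ => ⟨r, h.trans_lt hr, hx⟩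

theorem UTensor.homog_le_filt {l n : ℕ} {α : ℂ} {m r : ℤ} (h : m < r) {x : UTensor l n α}
    (hx : x ∈ homog l n α r) : x ∈ filt l n α m :=
  Ideal.subset_span ⟨r, h, hx⟩

theorem UTensor.filt_mul_homog {l n : ℕ} {α : ℂ} {m e : ℤ} {x a : UTensor l n α}
    (hx : x ∈ filt l n α (m - e)) (ha : a ∈ homog l n α e) : x * a ∈ filt l n α m := by
  induction hx using Submodule.span_induction with
  | mem x hx =>
    obtain ⟨r, hr, hx⟩ := hx
    exact homog_le_filt (by lia) (mul_mem_homog hx ha)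
  | zero => rw [zero_mul]; exact zero_mem _
  | add x y _ _ hx hy => rw [add_mul]; exact add_mem hx hy
  | smul c x _ hx => rw [smul_eq_mul, mul_assoc]; exact Ideal.mul_mem_left _ _ hx

theorem UTensor.iSup_homog (l n : ℕ) (α : ℂ) : ⨆ d, homog l n α d = ⊤ := by
  let S : Subalgebra ℂ (UTensor l n α) :=
    Submodule.toSubalgebra (⨆ d, homog l n α d) (Submodule.mem_iSup_of_mem 0 one_mem_homog) (by
      intro x y hx hy
      induction hx using Submodule.iSup_induction' with
      | zero => rw [zero_mul]; exact zero_mem _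
      | add x x' _ _ h h' => rw [add_mul]; exact add_mem h h'
      | mem d x hx =>
        induction hy using Submodule.iSup_induction' with
        | zero => rw [mul_zero]; exact zero_mem _
        | add x x' _ _ h h' => rw [mul_add]; exact add_mem h h'
        | mem e y hy => exact Submodule.mem_iSup_of_mem (d + e) (mul_mem_homog hx hy))
  have hS : S = ⊤ := subalgebra_eq_top S fun s X m =>
    Submodule.mem_iSup_of_mem (p := homog l n α) m (cur_mem_homog s X m)
  rw [eq_top_iff]
  intro x _
  exact (hS ▸ Algebra.mem_top : x ∈ S)

theorem UTensor.exists_filt_mul {l n : ℕ} {α : ℂ} (a : UTensor l n α) (m : ℤ) :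
    ∃ m', ∀ x ∈ filt l n α m', x * a ∈ filt l n α m := by
  have ha : a ∈ ⨆ d, homog l n α d := by rw [iSup_homog]; trivial
  induction ha using Submodule.iSup_induction' with
  | zero => exact ⟨0, fun x _ => by rw [mul_zero]; exact zero_mem _⟩
  | add a b _ _ h h' =>
    obtain ⟨i, hi⟩ := h
    obtain ⟨j, hj⟩ := h'
    refine ⟨max i j, fun x hx => ?_⟩
    rw [mul_add]
    exact add_mem (hi x (filt_anti (le_max_left _ _) hx)) (hj x (filt_anti (le_max_right _ _) hx))
  | mem e a ha => exact ⟨m - e, fun x hx => filt_mul_homog hx ha⟩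

theorem UTensor.basis (l n : ℕ) (α : ℂ) :
    RingSubgroupsBasis fun m : ℤ => (filt l n α m).toAddSubgroup where
  inter i j := ⟨max i j, le_inf (filt_anti (le_max_left _ _)) (filt_anti (le_max_right _ _))⟩
  mul i := ⟨i, by
    rintro _ ⟨x, _, y, hy, rfl⟩
    exact Ideal.mul_mem_left _ _ hy⟩
  leftMul x i := ⟨i, fun _ hy => Ideal.mul_mem_left _ _ hy⟩
  rightMul x i := exists_filt_mul x i

/-- The topology on `A` in which the left ideals `∑_{r > m} A A_r` are the basic neighbourhoods
of `0`. -/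
instance (l n : ℕ) (α : ℂ) : TopologicalSpace (UTensor l n α) := (UTensor.basis l n α).topology

instance (l n : ℕ) (α : ℂ) : NonarchimedeanRing (UTensor l n α) :=
  (UTensor.basis l n α).nonarchimedean

instance (l n : ℕ) (α : ℂ) : UniformSpace (UTensor l n α) :=
  IsTopologicalAddGroup.rightUniformSpace _

instance (l n : ℕ) (α : ℂ) : IsUniformAddGroup (UTensor l n α) :=
  isUniformAddGroup_of_addCommGroup

instance (l n : ℕ) (α : ℂ) : UniformContinuousConstSMul ℂ (UTensor l n α) where
  uniformContinuous_const_smul c := by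
    have : Continuous fun x : UTensor l n α => c • x := by
      simp only [Algebra.smul_def]
      fun_prop
    exact uniformContinuous_addMonoidHom_of_continuous (f := DistribSMul.toAddMonoidHom _ c) this

/-- The completion `lim_m A / ∑_{r > m} A A_r` of `A = U(𝔤𝔩̂ₙ^α)^{⊗ l}`, an algebra that contains
the degree-wise completion `UComp`. -/
abbrev UHat (l n : ℕ) (α : ℂ) : Type := UniformSpace.Completion (UTensor l n α)


/-- The canonical homomorphism from `A` to its completion. -/
def UHat.of (l n : ℕ) (α : ℂ) : UTensor l n α →ₐ[ℂ] UHat l n α :=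
  { UniformSpace.Completion.coeRingHom with commutes' := fun _ => rfl }

/-- The degree `d` component `lim_m (A_d / ∑_{r > m} A_{d-r} A_r)` of the degree-wise completion,
realised as the closure of `A_d` in the completion of `A`. -/
def UHat.homog (l n : ℕ) (α : ℂ) (d : ℤ) : Submodule ℂ (UHat l n α) :=
  ((UTensor.homog l n α d).map (UHat.of l n α).toLinearMap).topologicalClosure

theorem UHat.one_mem_homog {l n : ℕ} {α : ℂ} : (1 : UHat l n α) ∈ homog l n α 0 :=
  Submodule.le_topologicalClosure _ ⟨1, UTensor.one_mem_homog, map_one (UHat.of l n α)⟩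

theorem UHat.mul_mem_homog {l n : ℕ} {α : ℂ} {d e : ℤ} {x y : UHat l n α}
    (hx : x ∈ homog l n α d) (hy : y ∈ homog l n α e) : x * y ∈ homog l n α (d + e) := by
  refine map_mem_closure₂ continuous_mul hx hy ?_
  rintro _ ⟨a, ha, rfl⟩ _ ⟨b, hb, rfl⟩
  exact ⟨a * b, UTensor.mul_mem_homog ha hb, map_mul (UHat.of l n α) a b⟩

/-- The degree-wise completed tensor product `U(𝔤𝔩̂ₙ^α)_comp^{⊗ l}`, that is
`⨁_d lim_m (A_d / ∑_{r > m} A_{d-r} A_r)` for `A = U(𝔤𝔩̂ₙ^α)^{⊗ l}`. -/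
def UComp (l n : ℕ) (α : ℂ) : Subalgebra ℂ (UHat l n α) :=
  Submodule.toSubalgebra (⨆ d, UHat.homog l n α d)
    (Submodule.mem_iSup_of_mem 0 UHat.one_mem_homog) (by
      intro x y hx hy
      induction hx using Submodule.iSup_induction' with
      | zero => rw [zero_mul]; exact zero_mem _
      | add x x' _ _ h h' => rw [add_mul]; exact add_mem h h'
      | mem d x hx =>
        induction hy using Submodule.iSup_induction' with
        | zero => rw [mul_zero]; exact zero_mem _
        | add x x' _ _ h h' => rw [mul_add]; exact add_mem h h'
        | mem e y hy => exact Submodule.mem_iSup_of_mem (d + e) (UHat.mul_mem_homog hx hy))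

theorem UTensor.eta_mem_homog {l n : ℕ} {α : ℂ} (β : ℂ) {d : ℤ} {x : UTensor l n α}
    (hx : x ∈ homog l n α d) : eta l n α β x ∈ homog l n α d := by
  have hgen : ∀ (s : Fin l) (X : GlLie n) (m : ℤ), eta l n α β (cur α s X m) ∈ homog l n α m := by
    intro s X m
    have h : UAff.eta n α β (UAff.cur α X m) = UAff.cur α X m + algebraMap ℂ _ (β *
        AffineGl.traceZero n α (AffineGl.cur α X m)) := UAff.etaHom_ι β _
    rw [cur, eta_single, h, map_add, AlgHom.commutes, AffineGl.traceZero_cur]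
    refine add_mem (cur_mem_homog s X m) ?_
    split_ifs with hm
    · subst hm
      rw [Algebra.algebraMap_eq_smul_one]
      exact Submodule.smul_mem _ _ one_mem_homog
    · simp
  have hle : homog l n α d ≤ (homog l n α d).comap (eta l n α β).toLinearMap := by
    refine Submodule.span_le.mpr ?_
    rintro _ ⟨L, rfl, rfl⟩
    clear hx
    change eta l n α β _ ∈ homog l n α _
    induction L with
    | nil => simpa using one_mem_homog
    | cons p L ih =>
      simp only [List.map_cons, List.prod_cons, List.sum_cons, map_mul]
      exact mul_mem_homog (hgen _ _ _) ih
  exact hle hx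

theorem UTensor.eta_continuous (l n : ℕ) (α β : ℂ) : Continuous (eta l n α β) := by
  refine continuous_of_continuousAt_zero (eta l n α β) ?_
  rw [ContinuousAt, map_zero]
  refine ((UTensor.basis l n α).hasBasis_nhds_zero.tendsto_iff
    (UTensor.basis l n α).hasBasis_nhds_zero).mpr fun m _ => ⟨m, trivial, fun x hx => ?_⟩
  change x ∈ filt l n α m at hx
  change eta l n α β x ∈ filt l n α m
  induction hx using Submodule.span_induction with
  | mem x hx =>
    obtain ⟨r, hr, hx⟩ := hx
    exact homog_le_filt hr (eta_mem_homog β hx)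
  | zero => rw [map_zero]; exact zero_mem _
  | add x y _ _ hx hy => rw [map_add]; exact add_mem hx hy
  | smul c x _ hx => rw [smul_eq_mul, map_mul]; exact Ideal.mul_mem_left _ _ hx

theorem UTensor.eta_symm_apply {l n : ℕ} {α : ℂ} (β : ℂ) (x : UTensor l n α) :
    (eta l n α β).symm x = eta l n α (-β) x := rfl

/-- The continuous extension of `η_β^{⊗ l}` to the completion of `A`, as an endomorphism. -/
def UHat.etaHom (l n : ℕ) (α β : ℂ) : UHat l n α →ₐ[ℂ] UHat l n α :=
  { UniformSpace.Completion.mapRingHom ((UTensor.eta l n α β : UTensor l n α →ₐ[ℂ] UTensor l n α) :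
      UTensor l n α →+* UTensor l n α) (UTensor.eta_continuous l n α β) with
    commutes' := by
      intro c
      have h := UniformSpace.Completion.mapRingHom_coe
        (f := ((UTensor.eta l n α β : UTensor l n α →ₐ[ℂ] UTensor l n α) :
          UTensor l n α →+* UTensor l n α)) (UTensor.eta_continuous l n α β)
        (algebraMap ℂ (UTensor l n α) c)
      have h2 : ((UTensor.eta l n α β : UTensor l n α →ₐ[ℂ] UTensor l n α) :
          UTensor l n α →+* UTensor l n α) (algebraMap ℂ (UTensor l n α) c) =
          algebraMap ℂ (UTensor l n α) c := (UTensor.eta l n α β).commutes c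
      rw [h2] at h
      exact h }

theorem UHat.etaHom_of {l n : ℕ} {α : ℂ} (β : ℂ) (x : UTensor l n α) :
    etaHom l n α β (of l n α x) = of l n α (UTensor.eta l n α β x) :=
  UniformSpace.Completion.mapRingHom_coe
    (f := ((UTensor.eta l n α β : UTensor l n α →ₐ[ℂ] UTensor l n α) :
      UTensor l n α →+* UTensor l n α)) (UTensor.eta_continuous l n α β) x

theorem UHat.etaHom_continuous (l n : ℕ) (α β : ℂ) : Continuous (etaHom l n α β) :=
  UniformSpace.Completion.continuous_map

theorem UHat.etaHom_etaHom_neg {l n : ℕ} {α : ℂ} (β : ℂ) (x : UHat l n α) :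
    etaHom l n α β (etaHom l n α (-β) x) = x := by
  refine UniformSpace.Completion.induction_on x
    (isClosed_eq ((etaHom_continuous l n α β).comp (etaHom_continuous l n α (-β)))
      continuous_id) fun a => ?_
  change etaHom l n α β (etaHom l n α (-β) (of l n α a)) = of l n α a
  rw [etaHom_of, etaHom_of, ← UTensor.eta_symm_apply, AlgEquiv.apply_symm_apply]

/-- The continuous extension of `η_β^{⊗ l}` to the completion of `A`. -/
def UHat.eta (l n : ℕ) (α β : ℂ) : UHat l n α ≃ₐ[ℂ] UHat l n α :=
  AlgEquiv.ofAlgHom (etaHom l n α β) (etaHom l n α (-β))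
    (AlgHom.ext fun x => etaHom_etaHom_neg β x)
    (AlgHom.ext fun x => by
      have h := etaHom_etaHom_neg (-β) x
      rw [neg_neg] at h
      exact h)

theorem UHat.eta_of {l n : ℕ} {α : ℂ} (β : ℂ) (x : UTensor l n α) :
    eta l n α β (of l n α x) = of l n α (UTensor.eta l n α β x) :=
  etaHom_of β x

theorem UHat.eta_continuous (l n : ℕ) (α β : ℂ) : Continuous (eta l n α β) :=
  etaHom_continuous l n α β

theorem UHat.eta_mem_UComp {l n : ℕ} {α : ℂ} (β : ℂ) {x : UHat l n α} (hx : x ∈ UComp l n α) :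
    eta l n α β x ∈ UComp l n α := by
  change x ∈ ⨆ d, homog l n α d at hx
  change eta l n α β x ∈ ⨆ d, homog l n α d
  induction hx using Submodule.iSup_induction' with
  | zero => rw [map_zero]; exact zero_mem _
  | add x y _ _ h h' => rw [map_add]; exact add_mem h h'
  | mem d x hx =>
    refine Submodule.mem_iSup_of_mem d ?_
    refine map_mem_closure (eta_continuous l n α β) hx ?_
    rintro _ ⟨a, ha, rfl⟩
    exact ⟨_, UTensor.eta_mem_homog β ha, (eta_of β a).symm⟩

/-- The algebra automorphism `η_β^{⊗ l}` of `U(𝔤𝔩̂ₙ^α)_comp^{⊗ l}`. -/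
def UComp.eta (l n : ℕ) (α β : ℂ) : UComp l n α ≃ₐ[ℂ] UComp l n α where
  toFun x := ⟨UHat.eta l n α β (x : UHat l n α), UHat.eta_mem_UComp β x.2⟩
  invFun x := ⟨(UHat.eta l n α β).symm (x : UHat l n α), UHat.eta_mem_UComp (-β) x.2⟩
  left_inv x := Subtype.ext ((UHat.eta l n α β).symm_apply_apply (x : UHat l n α))
  right_inv x := Subtype.ext ((UHat.eta l n α β).apply_symm_apply (x : UHat l n α))
  map_mul' x y := Subtype.ext (map_mul (UHat.eta l n α β) (x : UHat l n α) y)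
  map_add' x y := Subtype.ext (map_add (UHat.eta l n α β) (x : UHat l n α) y)
  commutes' c := Subtype.ext ((UHat.eta l n α β).commutes c)

/-- The closure of the left ideal `∑_{r > m} A A_r` in the completion of `A`. -/
def UHat.filt (l n : ℕ) (α : ℂ) (m : ℤ) : Ideal (UHat l n α) where
  carrier := closure (of l n α '' UTensor.filt l n α m)
  zero_mem' := subset_closure ⟨0, zero_mem _, map_zero _⟩
  add_mem' hx hy := by
    refine map_mem_closure₂ continuous_add hx hy ?_
    rintro _ ⟨a, ha, rfl⟩ _ ⟨b, hb, rfl⟩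
    exact ⟨a + b, add_mem ha hb, map_add _ a b⟩
  smul_mem' c x hx := by
    have hc : c ∈ closure (Set.range (of l n α)) :=
      UniformSpace.Completion.denseRange_coe c
    refine map_mem_closure₂ continuous_mul hc hx ?_
    rintro _ ⟨a, rfl⟩ _ ⟨b, hb, rfl⟩
    exact ⟨a * b, Ideal.mul_mem_left _ _ hb, map_mul _ a b⟩

theorem UHat.isClosed_filt (l n : ℕ) (α : ℂ) (m : ℤ) : IsClosed (filt l n α m : Set (UHat l n α)) :=
  isClosed_closure

theorem UHat.smul_mem_filt {l n : ℕ} {α : ℂ} {m : ℤ} (c : ℂ) {x : UHat l n α}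
    (hx : x ∈ filt l n α m) : c • x ∈ filt l n α m := by
  rw [Algebra.smul_def]
  exact Ideal.mul_mem_left _ _ hx

theorem UHat.hasBasis_nhds_zero (l n : ℕ) (α : ℂ) :
    (nhds (0 : UHat l n α)).HasBasis (fun _ : ℤ => True) fun m => filt l n α m := by
  refine ⟨fun U => ⟨fun hU => ?_, ?_⟩⟩
  · obtain ⟨C, hC, hCc, hCU⟩ := exists_mem_nhds_isClosed_subset hU
    have h0 : (of l n α) ⁻¹' C ∈ nhds (0 : UTensor l n α) :=
      (UniformSpace.Completion.continuous_coe (UTensor l n α)).continuousAt hC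
    obtain ⟨m, -, hm⟩ := (UTensor.basis l n α).hasBasis_nhds_zero.mem_iff.mp h0
    exact ⟨m, trivial, (closure_minimal (Set.image_subset_iff.mpr hm) hCc).trans hCU⟩
  · rintro ⟨m, -, hm⟩
    refine Filter.mem_of_superset ?_ hm
    exact UniformSpace.Completion.isDenseInducing_coe.closure_image_mem_nhds
      ((UTensor.basis l n α).hasBasis_nhds_zero.mem_of_mem trivial)

/-- Fields `a(z) = ∑_m a_{(m)} z^{-m-1}` with coefficients in the completion of `A`: the families
`m ↦ a_{(m)}` with `a_{(m)} → 0` as `m → +∞`. A state `v` of the universal affine vertex algebra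
`V^κ(𝔤𝔩ₙ)^{⊗ l}` is identified with its generating field `∑_m (v t^m) z^{-m-1}`, where
`v t^m` is the element of the current algebra `U(𝔤𝔩̂ₙ^α)_comp^{⊗ l}` corresponding to the Fourier
coefficient `v_{(m)}`. Under this identification `V^κ(𝔤𝔩ₙ)^{⊗ l}` is the vertex algebra of fields
generated by the currents `Fld.cur α s X`, with the operations below. -/
def Fld (l n : ℕ) (α : ℂ) : Submodule ℂ (ℤ → UHat l n α) where
  carrier := {a | Filter.Tendsto a Filter.atTop (nhds 0)}
  zero_mem' := tendsto_const_nhds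
  add_mem' {a b} ha hb := by
    have h := Filter.Tendsto.add ha hb
    rw [add_zero] at h
    exact h
  smul_mem' c a ha := by
    have h := Filter.Tendsto.const_smul ha c
    rw [smul_zero] at h
    exact h

theorem Fld.mem_iff {l n : ℕ} {α : ℂ} {a : ℤ → UHat l n α} :
    a ∈ Fld l n α ↔ ∀ M, ∃ N, ∀ m, N ≤ m → a m ∈ UHat.filt l n α M := by
  change Filter.Tendsto a Filter.atTop (nhds 0) ↔ _
  rw [(Filter.atTop_basis (α := ℤ)).tendsto_iff (UHat.hasBasis_nhds_zero l n α)]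
  simp

/-- The `j`-th term of the Borcherds formula for the `m`-th mode of `a_{(k)} b`. -/
def Fld.nthTerm {l n : ℕ} {α : ℂ} (k : ℤ) (a b : ℤ → UHat l n α) (m : ℤ) (j : ℕ) : UHat l n α :=
  ((-1 : ℂ) ^ j * (Ring.choose k j : ℤ)) •
    (a (k - j) * b (m + j) - (-1 : ℂ) ^ k • (b (m + k - j) * a j))

theorem Fld.summable_nthTerm {l n : ℕ} {α : ℂ} (k : ℤ) (a b : Fld l n α) (m : ℤ) :
    Summable (Fld.nthTerm k (a : ℤ → UHat l n α) b m) := by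
  apply NonarchimedeanAddGroup.summable_of_tendsto_cofinite_zero
  rw [Nat.cofinite_eq_atTop, (Filter.atTop_basis (α := ℕ)).tendsto_iff
    (UHat.hasBasis_nhds_zero l n α)]
  intro M _
  obtain ⟨N, hN⟩ := Fld.mem_iff.mp a.2 M
  obtain ⟨N', hN'⟩ := Fld.mem_iff.mp b.2 M
  refine ⟨max N.toNat (N' - m).toNat, trivial, fun j hj => ?_⟩
  have hj' : max N.toNat (N' - m).toNat ≤ j := hj
  refine UHat.smul_mem_filt _ (sub_mem ?_ (UHat.smul_mem_filt _ ?_))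
  · exact Ideal.mul_mem_left _ _ (hN' _ (by lia))
  · exact Ideal.mul_mem_left _ _ (hN _ (by lia))

theorem Fld.nthProd_mem {l n : ℕ} {α : ℂ} (k : ℤ) (a b : Fld l n α) :
    (fun m => ∑' j, Fld.nthTerm k (a : ℤ → UHat l n α) b m j) ∈ Fld l n α := by
  rw [Fld.mem_iff]
  intro M
  obtain ⟨N, hN⟩ := Fld.mem_iff.mp a.2 M
  obtain ⟨N', hN'⟩ := Fld.mem_iff.mp b.2 M
  have hfin : ∀ j : ℕ, ∃ K, ∀ m, K ≤ m →
      (b : ℤ → UHat l n α) m * (a : ℤ → UHat l n α) j ∈ UHat.filt l n α M := by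
    intro j
    have h1 : Filter.Tendsto (fun m => (b : ℤ → UHat l n α) m * (a : ℤ → UHat l n α) j)
        Filter.atTop (nhds 0) := by
      have h2 : Filter.Tendsto (b : ℤ → UHat l n α) Filter.atTop (nhds 0) := b.2
      simpa using h2.mul_const ((a : ℤ → UHat l n α) j)
    exact Fld.mem_iff.mp h1 M
  choose K hK using hfin
  obtain ⟨B, hB⟩ : ∃ B, ∀ j < N.toNat, K j ≤ B := by
    obtain ⟨B, hB⟩ := ((Finset.range N.toNat).image K).bddAbove
    exact ⟨B, fun j hj => hB (by simpa using ⟨j, by lia, rfl⟩)⟩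
  refine ⟨max N' (B - k + N.toNat), fun m hm => ?_⟩
  refine (UHat.isClosed_filt l n α M).mem_of_tendsto (Fld.summable_nthTerm k a b m).hasSum
    (Filter.Eventually.of_forall fun t => sum_mem fun j _ => ?_)
  refine UHat.smul_mem_filt _ (sub_mem ?_ (UHat.smul_mem_filt _ ?_))
  · exact Ideal.mul_mem_left _ _ (hN' _ (by lia))
  · by_cases hj : j < N.toNat
    · exact hK j _ (by have := hB j hj; lia)
    · exact Ideal.mul_mem_left _ _ (hN _ (by lia))

/-- The `k`-th product of fields,
`(a_{(k)} b)_{(m)} = ∑_{j ≥ 0} (-1)^j (k choose j) (a_{(k-j)} b_{(m+j)} - (-1)^k b_{(m+k-j)} a_{(j)})`.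
The series converges by `Fld.summable_nthTerm`. For `k = -1` it is the normally ordered product. -/
def Fld.nthProd {l n : ℕ} {α : ℂ} (k : ℤ) (a b : Fld l n α) : Fld l n α :=
  ⟨fun m => ∑' j, Fld.nthTerm k (a : ℤ → UHat l n α) b m j, Fld.nthProd_mem k a b⟩

/-- The operator `a_{(k)} : b ↦ a_{(k)} b`. -/
def Fld.nthMode {l n : ℕ} {α : ℂ} (a : Fld l n α) (k : ℤ) : Module.End ℂ (Fld l n α) where
  toFun b := Fld.nthProd k a b
  map_add' b c := by
    refine Subtype.ext (funext fun m => ?_)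
    refine Eq.trans ?_
      ((Fld.summable_nthTerm k a b m).tsum_add (Fld.summable_nthTerm k a c m))
    refine tsum_congr fun j => ?_
    simp only [Fld.nthTerm, Submodule.coe_add, Pi.add_apply, mul_add, add_mul, smul_sub, smul_add]
    abel
  map_smul' c b := by
    refine Subtype.ext (funext fun m => ?_)
    refine Eq.trans ?_ ((Fld.summable_nthTerm k a b m).tsum_const_smul c)
    refine tsum_congr fun j => ?_
    simp only [Fld.nthTerm, Submodule.coe_smul, Pi.smul_apply, mul_smul_comm, smul_mul_assoc,
      smul_sub, smul_comm c]

/-- The vacuum `|0⟩`, that is the constant field `1`. -/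
def Fld.vac (l n : ℕ) (α : ℂ) : Fld l n α :=
  ⟨fun m => if m = -1 then 1 else 0, Fld.mem_iff.mpr fun M => ⟨0, fun m hm => by
    rw [if_neg (by lia)]; exact zero_mem _⟩⟩

/-- The translation operator, `T a(z) = d/dz a(z)`, that is `(T a)_{(m)} = -m a_{(m-1)}`. -/
def Fld.T (l n : ℕ) (α : ℂ) : Module.End ℂ (Fld l n α) where
  toFun a := ⟨fun m => (-m : ℂ) • (a : ℤ → UHat l n α) (m - 1), Fld.mem_iff.mpr fun M => by
    obtain ⟨N, hN⟩ := Fld.mem_iff.mp a.2 M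
    exact ⟨N + 1, fun m hm => UHat.smul_mem_filt _ (hN _ (by lia))⟩⟩
  map_add' a b := Subtype.ext (funext fun m => smul_add _ _ _)
  map_smul' c a := Subtype.ext (funext fun m =>
    smul_comm (-m : ℂ) c ((a : ℤ → UHat l n α) (m - 1)))

/-- The state `X^{[s]}[-1]`, that is the field `∑_m X^{[s]}(m) z^{-m-1}`. -/
def Fld.cur {l n : ℕ} (α : ℂ) (s : Fin l) (X : GlLie n) : Fld l n α :=
  ⟨fun m => UHat.of l n α (UTensor.cur α s X m), Fld.mem_iff.mpr fun M => ⟨M + 1, fun m hm =>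
    subset_closure ⟨_, UTensor.homog_le_filt (by lia) (UTensor.cur_mem_homog s X m), rfl⟩⟩⟩

/-- The matrix `A^{[s]}`, whose `(i,j)`-entry is the operator `E_{i,j}^{[s]}[-1]_{(-1)}`. -/
def miuraFactor {l n : ℕ} (α : ℂ) (s : Fin l) :
    Matrix (Fin n) (Fin n) (Module.End ℂ (Fld l n α)) :=
  Matrix.of fun i j => Fld.nthMode (Fld.cur α s (GlLie.E i j)) (-1)

/-- Right multiplication by `τ + A` of an expression `∑_r τ^{N-r} P^{(r)}` whose coefficients
`P^{(r)}` are matrices of operators. Here `τ` is the formal operator with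
`[X[-m]_{(-1)}, τ] = α m X[-m-1]_{(-1)} = α [T, X[-m]_{(-1)}]`, so that
`D τ = τ D + α [T, D]` for products `D` of such operators and the coefficient of `τ^{N+1-r}` in
`(∑_r τ^{N-r} P^{(r)}) (τ + A)` is `P^{(r)} + α [T, P^{(r-1)}] + P^{(r-1)} A`. -/
def miuraStep {l n : ℕ} (α : ℂ) (P : ℕ → Matrix (Fin n) (Fin n) (Module.End ℂ (Fld l n α)))
    (A : Matrix (Fin n) (Fin n) (Module.End ℂ (Fld l n α))) :
    ℕ → Matrix (Fin n) (Fin n) (Module.End ℂ (Fld l n α))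
  | 0 => P 0
  | r + 1 => P (r + 1) +
      (α • (P r).map (fun D => Fld.T l n α * D - D * Fld.T l n α) + P r * A)

/-- The operator-valued matrices `P^{(r)}` with
`(τ + A^{[1]}) (τ + A^{[2]}) ⋯ (τ + A^{[l]}) = τ^l + ∑_{r=1}^l τ^{l-r} P^{(r)}`. -/
def miuraCoeff (l n : ℕ) (α : ℂ) : ℕ → Matrix (Fin n) (Fin n) (Module.End ℂ (Fld l n α)) :=
  ((List.finRange l).map (miuraFactor α)).foldl (miuraStep α) (Pi.single 0 1)

/-- The element `W_{i,j}^{(r)}`: the `(i,j)`-entry of the coefficient of `τ^{l-r}` in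
`(τ + A^{[1]}) ⋯ (τ + A^{[l]})`, a linear combination of operators
`X_1[-m_1]_{(-1)} ⋯ X_a[-m_a]_{(-1)}` which is turned into a state by replacing the right-most
factor by the state `X_a[-m_a]`, that is by application to the vacuum. -/
def wField (l n : ℕ) (α : ℂ) (r : ℕ) (i j : Fin n) : Fld l n α :=
  miuraCoeff l n α r i j (Fld.vac l n α)

/-- A space of fields that contains the vacuum and is closed under all `k`-th products. -/
structure IsVertexSubalgebra {l n : ℕ} {α : ℂ} (V : Submodule ℂ (Fld l n α)) : Prop where
  vac_mem : Fld.vac l n α ∈ V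
  nthProd_mem : ∀ a ∈ V, ∀ b ∈ V, ∀ k : ℤ, Fld.nthProd k a b ∈ V

/-- The vertex algebra generated by a set of fields. -/
def vertexSpan {l n : ℕ} {α : ℂ} (S : Set (Fld l n α)) : Submodule ℂ (Fld l n α) :=
  sInf {V | IsVertexSubalgebra V ∧ S ⊆ V}

/-- The rectangular W-algebra `𝒲^κ(𝔤𝔩_{ln}, (l^n))` with `α = k + (l-1) n`, regarded through the Miura
map as a vertex subalgebra of `V^κ(𝔤𝔩ₙ)^{⊗ l}`: the one generated by the Arakawa-Molev elements
`W_{i,j}^{(r)}`, `1 ≤ r ≤ l`. -/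
def WAlgebra (l n : ℕ) (α : ℂ) : Submodule ℂ (Fld l n α) :=
  vertexSpan {a | ∃ r i j, 1 ≤ r ∧ r ≤ l ∧ a = wField l n α r i j}

/-- The current algebra of a vertex subalgebra `V`, regarded as a subalgebra of
`U(𝔤𝔩̂ₙ^α)_comp^{⊗ l}`: the closed subalgebra topologically generated by all Fourier coefficients
`v t^m`, `v ∈ V`, `m ∈ ℤ`. If the algebra `S` generated by the `v t^m` is graded, this is
`⨁_d` of the closures of the `S_d` in the degree `d` components of `U(𝔤𝔩̂ₙ^α)_comp^{⊗ l}`. -/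
def currentAlgebra {l n : ℕ} {α : ℂ} (V : Submodule ℂ (Fld l n α)) : Subalgebra ℂ (UComp l n α) :=
  ((Algebra.adjoin ℂ {x | ∃ a ∈ V, ∃ m : ℤ, x = (a : ℤ → UHat l n α) m}).topologicalClosure).comap
    (UComp l n α).val

/-- The parameter `α = k + (l - 1) n`. -/
def level (l n : ℕ) (k : ℂ) : ℂ := k + ((l : ℂ) - 1) * n

end RectangularW

end

/-!
The automorphism `η_β^{⊗ l}` extends to the fields, coefficientwise. There it is compatible with all
`k`-th products and with `T`, fixes the vacuum, and sends the current `E_{i,j}^{[s]}(z)` to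
`E_{i,j}^{[s]}(z) + δ_{i,j} β z⁻¹`. Multiplication by `z⁻¹` commutes with the operators
`a_{(k)}` and satisfies `[T, z⁻¹] = -z⁻²`, so that in the Miura product `τ` may be moved past it:
`η_β` replaces every factor `τ + A^{[s]}` by `τ + β z⁻¹ + A^{[s]}`, and the new product is
`∑_q (τ + β z⁻¹)^{l-q} W^{(q)}`. Hence
`η_β W^{(r)} = ∑_{q + p = r} (l-q choose p) β (β - α) ⋯ (β - (p-1) α) z^{-p} W^{(q)}`
(`etaFld_wField`; the combinatorial core is `foldl_ringMiuraStep_add`).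

The field `z^{-p} W^{(q)}(z)` has the Fourier coefficients of `W^{(q)}(z)`, shifted. On the other hand
the fields whose Fourier coefficients lie in a given closed subalgebra form a vertex subalgebra, because
the Borcherds formula expresses the coefficients of `a_{(k)} b` by convergent series in those of `a`
and `b`. So it suffices to control the coefficients of the generators, and `η_β` maps the current
algebra into itself. Applying this to `-β` as well gives equality.
-/

noncomputable section

namespace RectangularW

open Finset.HasAntidiagonal (antidiagonal mem_antidiagonal)

/-! ### Miura products in an associative algebra -/

section Miura

variable {R : Type*} [Ring R] [Algebra ℂ R]

/-- Right multiplication by `τ + A` of an expression `∑_r τ^{N-r} P_r` with coefficients in `R`, where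
`D τ = τ D + α [T, D]`. This is `miuraStep` with the matrices of operators replaced by elements of an
arbitrary algebra. -/
def ringMiuraStep (α : ℂ) (T : R) (P : ℕ → R) (A : R) : ℕ → R
  | 0 => P 0
  | r + 1 => P (r + 1) + (α • (T * P r - P r * T) + P r * A)

theorem map_foldl_ringMiuraStep {S : Type*} [Ring S] [Algebra ℂ S] (φ : R →ₐ[ℂ] S) (α : ℂ) (T : R)
    (As : List R) (P : ℕ → R) (r : ℕ) :
    φ (As.foldl (ringMiuraStep α T) P r) =
      (As.map φ).foldl (ringMiuraStep α (φ T)) (fun q => φ (P q)) r := by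
  induction As generalizing P with
  | nil => rfl
  | cons A As ih =>
    rw [List.foldl_cons, ih, List.map_cons, List.foldl_cons]
    have h : (fun q => φ (ringMiuraStep α T P A q)) =
        ringMiuraStep α (φ T) (fun q => φ (P q)) (φ A) := by
      funext q
      cases q <;> simp [ringMiuraStep]
    rw [h]

/-- The coefficient of `τ^{N-p} M^p` in `(τ + β M)^N`, where `M τ = τ M - α M²`. It is
defined for all integers `N`, for which Pascal's rule holds without restriction. -/
def shiftCoeff (α β : ℂ) (N : ℤ) (p : ℕ) : ℂ :=
  (Ring.choose N p : ℤ) * ∏ i ∈ Finset.range p, (β - α * i)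

theorem shiftCoeff_zero (α β : ℂ) (N : ℤ) : shiftCoeff α β N 0 = 1 := by
  simp [shiftCoeff]

theorem shiftCoeff_succ (α β : ℂ) (N : ℤ) (p : ℕ) :
    shiftCoeff α β (N + 1) (p + 1) =
      shiftCoeff α β N (p + 1) + shiftCoeff α β N p * (β - α * p) := by
  simp only [shiftCoeff, Ring.choose_succ_succ, Finset.prod_range_succ]
  push_cast
  ring

theorem shiftCoeff_nil (α β : ℂ) (p : ℕ) : shiftCoeff α β 0 (p + 1) = 0 := by
  simp [shiftCoeff]

variable {T M : R}

theorem commute_foldl_ringMiuraStep (hTM : T * M = M * T - M * M) (α : ℂ) (As : List R)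
    (hA : ∀ A ∈ As, Commute M A) (P : ℕ → R) (hP : ∀ r, Commute M (P r)) (r : ℕ) :
    Commute M (As.foldl (ringMiuraStep α T) P r) := by
  induction As generalizing P with
  | nil => exact hP r
  | cons A As ih =>
    refine ih (fun B hB => hA B (List.mem_cons_of_mem _ hB)) _ fun q => ?_
    cases q with
    | zero => exact hP 0
    | succ q =>
      refine (hP _).add_right (Commute.add_right (Commute.smul_right ?_ α)
        ((hP q).mul_right (hA A List.mem_cons_self)))
      -- By the Jacobi identity, `[M, [T, P]] = [[M, T], P] = [M², P] = 0`.
      have h : M * P q = P q * M := hP q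
      have hMT : M * T = T * M + M * M := by rw [hTM]; abel
      change M * (T * P q - P q * T) = (T * P q - P q * T) * M
      rw [mul_sub, sub_mul, ← mul_assoc, ← mul_assoc, hMT, h, mul_assoc (P q) M T, hMT]
      simp only [add_mul, mul_add, mul_assoc, h]
      rw [← mul_assoc M (P q) M, h]
      simp only [mul_assoc]
      abel

theorem mul_pow_of_mul_eq (hTM : T * M = M * T - M * M) (p : ℕ) :
    T * M ^ p = M ^ p * T - (p : ℂ) • M ^ (p + 1) := by
  induction p with
  | zero => simp
  | succ p ih =>
    rw [pow_succ M p, ← mul_assoc, ih, sub_mul, mul_assoc, hTM, mul_sub, ← mul_assoc, smul_mul_assoc,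
      ← pow_succ M (p + 1), ← mul_assoc, ← pow_succ, ← pow_succ]
    push_cast
    rw [add_smul, one_smul]
    abel

/-- The coefficients of `∏_s (τ + β M + A_s) = ∑_q (τ + β M)^{N-q} P_q`, where
`∏_s (τ + A_s) = ∑_q τ^{N-q} P_q` and `M` commutes with the `A_s`. -/
theorem foldl_ringMiuraStep_add (hTM : T * M = M * T - M * M) (α β : ℂ) (As : List R)
    (hA : ∀ A ∈ As, Commute M A) (r : ℕ) :
    (As.map (· + β • M)).foldl (ringMiuraStep α T) (Pi.single 0 1) r =
      ∑ x ∈ antidiagonal r, shiftCoeff α β (As.length - x.1) x.2 •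
        (M ^ x.2 * As.foldl (ringMiuraStep α T) (Pi.single 0 1) x.1) := by
  induction As using List.reverseRecOn generalizing r with
  | nil =>
    cases r with
    | zero => simp [shiftCoeff_zero]
    | succ r =>
      rw [Finset.Nat.sum_antidiagonal_succ]
      simp [shiftCoeff_nil]
  | append_singleton As A ih =>
    have hA' : ∀ B ∈ As, Commute M B := fun B hB => hA B (by simp [hB])
    have hcomm : ∀ q, Commute M (As.foldl (ringMiuraStep α T) (Pi.single 0 1) q) :=
      commute_foldl_ringMiuraStep hTM α As hA' _ fun q => by
        cases q <;> simp
    specialize ih hA'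
    simp only [List.map_append, List.map_cons, List.map_nil, List.foldl_append, List.foldl_cons,
      List.foldl_nil, List.length_append, List.length_singleton]
    generalize As.foldl (ringMiuraStep α T) (Pi.single 0 1) = P at *
    generalize (As.map (· + β • M)).foldl (ringMiuraStep α T) (Pi.single 0 1) = Q at *
    cases r with
    | zero => simp [ringMiuraStep, ih, shiftCoeff_zero]
    | succ r =>
      have hterm : ∀ (q p : ℕ) (c : ℂ), α • (T * (c • (M ^ p * P q)) - (c • (M ^ p * P q)) * T) +
          (c • (M ^ p * P q)) * (A + β • M) =
          c • (M ^ p * (α • (T * P q - P q * T) + P q * A)) +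
            (c * (β - α * p)) • (M ^ (p + 1) * P q) := by
        intro q p c
        have h1 : M ^ p * P q * M = M ^ (p + 1) * P q := by
          rw [mul_assoc, ← (hcomm q).eq, ← mul_assoc, pow_succ]
        have h2 : T * (M ^ p * P q) = M ^ p * (T * P q) - (p : ℂ) • (M ^ (p + 1) * P q) := by
          rw [← mul_assoc, mul_pow_of_mul_eq hTM, sub_mul, smul_mul_assoc, mul_assoc]
        simp only [mul_smul_comm, smul_mul_assoc, mul_add, mul_sub, h1, h2, smul_sub, smul_add,
          mul_assoc]
        module
      -- The summands of both sides are matched after splitting off `p = 0`, which leaves Pascal's rule.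
      have hpascal : ∑ x ∈ antidiagonal (r + 1),
            shiftCoeff α β (As.length - x.1) x.2 • (M ^ x.2 * P x.1) +
          ∑ x ∈ antidiagonal r, (shiftCoeff α β (As.length - x.1) x.2 * (β - α * x.2)) •
            (M ^ (x.2 + 1) * P x.1) =
          ∑ x ∈ antidiagonal (r + 1),
            shiftCoeff α β (As.length + 1 - x.1) x.2 • (M ^ x.2 * P x.1) := by
        rw [Finset.Nat.sum_antidiagonal_succ', Finset.Nat.sum_antidiagonal_succ', add_assoc,
          ← Finset.sum_add_distrib]
        congr 1
        · simp [shiftCoeff_zero]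
        · refine Finset.sum_congr rfl fun x _ => ?_
          rw [← add_smul, ← shiftCoeff_succ, sub_add_eq_add_sub]
      rw [Finset.Nat.sum_antidiagonal_succ]
      simp only [ringMiuraStep, ih]
      rw [Finset.mul_sum, Finset.sum_mul, Finset.sum_mul, ← Finset.sum_sub_distrib, Finset.smul_sum,
        ← Finset.sum_add_distrib, Finset.sum_congr rfl fun x (_ : x ∈ antidiagonal r) => hterm x.1 x.2 _,
        Finset.sum_add_distrib, add_left_comm, hpascal, Finset.Nat.sum_antidiagonal_succ,
        add_left_comm, ← Finset.sum_add_distrib]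
      push_cast
      congr 1
      refine Finset.sum_congr rfl fun x _ => ?_
      rw [add_sub_add_right_eq_sub, add_comm, ← smul_add, ← mul_add]

end Miura

/-! ### Operators on fields -/

variable {l n : ℕ} {α : ℂ}

theorem Fld.nthProd_apply (k : ℤ) (a b : Fld l n α) (m : ℤ) :
    (Fld.nthProd k a b : ℤ → UHat l n α) m = ∑' j, Fld.nthTerm k (a : ℤ → UHat l n α) b m j := rfl

/-- Multiplication of fields by `z⁻¹`, which shifts the Fourier coefficients by one. -/
def Fld.invZ (l n : ℕ) (α : ℂ) : Module.End ℂ (Fld l n α) where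
  toFun a := ⟨fun m => (a : ℤ → UHat l n α) (m - 1), Fld.mem_iff.mpr fun M => by
    obtain ⟨N, hN⟩ := Fld.mem_iff.mp a.2 M
    exact ⟨N + 1, fun m hm => hN _ (by lia)⟩⟩
  map_add' _ _ := rfl
  map_smul' _ _ := rfl

theorem Fld.invZ_apply (a : Fld l n α) (m : ℤ) :
    (Fld.invZ l n α a : ℤ → UHat l n α) m = (a : ℤ → UHat l n α) (m - 1) := rfl

theorem Fld.invZ_pow_apply (p : ℕ) (a : Fld l n α) (m : ℤ) :
    ((Fld.invZ l n α ^ p) a : ℤ → UHat l n α) m = (a : ℤ → UHat l n α) (m - p) := by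
  induction p generalizing m with
  | zero => simp
  | succ p ih =>
    rw [pow_succ', Module.End.mul_apply, invZ_apply, ih]
    push_cast
    rw [sub_sub, add_comm 1]

theorem Fld.T_mul_invZ : Fld.T l n α * Fld.invZ l n α =
    Fld.invZ l n α * Fld.T l n α - Fld.invZ l n α * Fld.invZ l n α := by
  refine LinearMap.ext fun a => Subtype.ext (funext fun m => ?_)
  change (-m : ℂ) • (a : ℤ → UHat l n α) (m - 1 - 1) =
    (-((m - 1 : ℤ) : ℂ)) • (a : ℤ → UHat l n α) (m - 1 - 1) - (a : ℤ → UHat l n α) (m - 1 - 1)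
  push_cast
  module

theorem Fld.commute_invZ_nthMode (a : Fld l n α) (k : ℤ) :
    Commute (Fld.invZ l n α) (Fld.nthMode a k) := by
  refine LinearMap.ext fun b => Subtype.ext (funext fun m => ?_)
  refine tsum_congr fun j => ?_
  simp only [nthTerm, invZ_apply]
  rw [show m - 1 + j = m + j - 1 by ring, show m - 1 + k - j = m + k - j - 1 by ring]

theorem Fld.nthProd_add_left (k : ℤ) (a b c : Fld l n α) :
    Fld.nthProd k (a + b) c = Fld.nthProd k a c + Fld.nthProd k b c := by
  refine Subtype.ext (funext fun m => ?_)
  refine Eq.trans ?_ ((Fld.summable_nthTerm k a c m).tsum_add (Fld.summable_nthTerm k b c m))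
  refine tsum_congr fun j => ?_
  simp only [Fld.nthTerm, Submodule.coe_add, Pi.add_apply, mul_add, add_mul, smul_sub, smul_add]
  abel

theorem Fld.nthProd_smul_left (k : ℤ) (c : ℂ) (a b : Fld l n α) :
    Fld.nthProd k (c • a) b = c • Fld.nthProd k a b := by
  refine Subtype.ext (funext fun m => ?_)
  refine Eq.trans ?_ ((Fld.summable_nthTerm k a b m).tsum_const_smul c)
  refine tsum_congr fun j => ?_
  simp only [Fld.nthTerm, Submodule.coe_smul, Pi.smul_apply, mul_smul_comm, smul_mul_assoc,
    smul_sub, smul_comm c]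

theorem Fld.nthProd_invZ_vac (b : Fld l n α) :
    Fld.nthProd (-1) (Fld.invZ l n α (Fld.vac l n α)) b = Fld.invZ l n α b := by
  refine Subtype.ext (funext fun m => ?_)
  have hz : ∀ i : ℤ, (Fld.invZ l n α (Fld.vac l n α) : ℤ → UHat l n α) i = if i = 0 then 1 else 0 := by
    intro i
    rw [invZ_apply]
    exact if_congr (by lia) rfl rfl
  -- Only `j = 0` contributes, through `b_{(m-1)} (z⁻¹)_{(0)}`, as `(z⁻¹)_{(i)} = δ_{i,0}`.
  rw [nthProd_apply, tsum_eq_single 0]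
  · simp [nthTerm, hz, invZ_apply, sub_eq_add_neg]
  · intro j hj
    have h1 : ¬ ((-1 : ℤ) - j = 0) := by lia
    simp [nthTerm, hz, h1, hj]

/-! ### The automorphism on fields -/

/-- `η_β^{⊗ l}` applied to the Fourier coefficients of a field. -/
def etaFldHom (l n : ℕ) (α β : ℂ) : Module.End ℂ (Fld l n α) where
  toFun a := ⟨fun m => UHat.eta l n α β ((a : ℤ → UHat l n α) m), by
    have h : Filter.Tendsto (a : ℤ → UHat l n α) Filter.atTop (nhds 0) := a.2
    have h' := ((UHat.eta_continuous l n α β).tendsto 0).comp h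
    rw [map_zero] at h'
    exact h'⟩
  map_add' _ _ := Subtype.ext (funext fun _ => map_add _ _ _)
  map_smul' c a := by
    refine Subtype.ext (funext fun m => ?_)
    change UHat.eta l n α β (c • (a : ℤ → UHat l n α) m) =
      c • UHat.eta l n α β ((a : ℤ → UHat l n α) m)
    exact map_smul _ _ _

theorem UHat.eta_neg_eta (β : ℂ) (x : UHat l n α) : eta l n α (-β) (eta l n α β x) = x :=
  (eta l n α β).symm_apply_apply x

theorem UHat.eta_eta_neg (β : ℂ) (x : UHat l n α) : eta l n α β (eta l n α (-β) x) = x :=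
  (eta l n α β).apply_symm_apply x

/-- The linear automorphism of the space of fields induced by `η_β^{⊗ l}`. -/
def etaFld (l n : ℕ) (α β : ℂ) : Fld l n α ≃ₗ[ℂ] Fld l n α :=
  { etaFldHom l n α β with
    invFun := etaFldHom l n α (-β)
    left_inv := fun _ => Subtype.ext (funext fun _ => UHat.eta_neg_eta β _)
    right_inv := fun _ => Subtype.ext (funext fun _ => UHat.eta_eta_neg β _) }

theorem etaFld_apply (β : ℂ) (a : Fld l n α) (m : ℤ) :
    (etaFld l n α β a : ℤ → UHat l n α) m = UHat.eta l n α β ((a : ℤ → UHat l n α) m) := rfl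

theorem etaFld_vac (β : ℂ) : etaFld l n α β (Fld.vac l n α) = Fld.vac l n α := by
  refine Subtype.ext (funext fun m => ?_)
  rw [etaFld_apply]
  change UHat.eta l n α β (if m = -1 then 1 else 0) = if m = -1 then 1 else 0
  split_ifs <;> simp

theorem etaFld_T (β : ℂ) (a : Fld l n α) :
    etaFld l n α β (Fld.T l n α a) = Fld.T l n α (etaFld l n α β a) :=
  Subtype.ext (funext fun _ => map_smul (UHat.eta l n α β) _ _)

theorem etaFld_nthProd (β : ℂ) (k : ℤ) (a b : Fld l n α) :
    etaFld l n α β (Fld.nthProd k a b) =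
      Fld.nthProd k (etaFld l n α β a) (etaFld l n α β b) := by
  refine Subtype.ext (funext fun m => ?_)
  rw [etaFld_apply, Fld.nthProd_apply, Fld.nthProd_apply,
    (Fld.summable_nthTerm k a b m).map_tsum (UHat.eta l n α β) (UHat.eta_continuous l n α β)]
  refine tsum_congr fun j => ?_
  simp only [Fld.nthTerm, etaFld_apply, map_smul, map_sub, map_mul]

/-- `η_β` sends `E_{i,j}^{[s]}(z)` to `E_{i,j}^{[s]}(z) + δ_{i,j} β z⁻¹`; here `z⁻¹` is the field
`Fld.invZ` applied to the vacuum, whose only non-zero coefficient is `1` at `0`. -/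
theorem etaFld_cur (β : ℂ) (s : Fin l) (i j : Fin n) :
    etaFld l n α β (Fld.cur α s (GlLie.E i j)) = Fld.cur α s (GlLie.E i j) +
      (if i = j then β else 0) • Fld.invZ l n α (Fld.vac l n α) := by
  refine Subtype.ext (funext fun m => ?_)
  have h : (if m = 0 ∧ i = j then β else 0) =
      (if i = j then β else 0) * (if m - 1 = -1 then 1 else 0) := by
    have : m - 1 = -1 ↔ m = 0 := by lia
    by_cases hm : m = 0 <;> by_cases hij : i = j <;> simp [hm, hij, this]
  change UHat.eta l n α β (UHat.of l n α (UTensor.single s (UAff.cur α (GlLie.E i j) m))) =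
    UHat.of l n α (UTensor.single s (UAff.cur α (GlLie.E i j) m)) +
      (if i = j then β else 0) • (if m - 1 = -1 then 1 else 0)
  rw [UHat.eta_of, UTensor.eta_single, UAff.eta_cur_E, map_add, map_add, AlgHom.commutes,
    AlgHom.commutes, h, Algebra.algebraMap_eq_smul_one, mul_smul]
  congr 2
  split_ifs <;> simp

/-! ### The Miura generators -/

theorem miuraStep_eq (P : ℕ → Matrix (Fin n) (Fin n) (Module.End ℂ (Fld l n α)))
    (A : Matrix (Fin n) (Fin n) (Module.End ℂ (Fld l n α))) :
    miuraStep α P A = ringMiuraStep α (Matrix.scalar (Fin n) (Fld.T l n α)) P A := by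
  funext r
  cases r with
  | zero => rfl
  | succ r =>
    simp only [miuraStep, ringMiuraStep]
    congr 3
    ext1 i j
    simp [Matrix.scalar_apply]

theorem miuraCoeff_eq (l n : ℕ) (α : ℂ) : miuraCoeff l n α =
    ((List.finRange l).map (miuraFactor α)).foldl
      (ringMiuraStep α (Matrix.scalar (Fin n) (Fld.T l n α))) (Pi.single 0 1) := by
  rw [miuraCoeff, show miuraStep α = ringMiuraStep α (Matrix.scalar (Fin n) (Fld.T l n α)) from
    funext fun P => funext fun A => miuraStep_eq P A]

/-- Conjugation by `η_β^{⊗ l}` on matrices of operators on fields. -/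
def conjEta (l n : ℕ) (α β : ℂ) : Matrix (Fin n) (Fin n) (Module.End ℂ (Fld l n α)) →ₐ[ℂ]
    Matrix (Fin n) (Fin n) (Module.End ℂ (Fld l n α)) :=
  ((etaFld l n α β).conjAlgEquiv ℂ : _ →ₐ[ℂ] _).mapMatrix

theorem conjEta_apply (β : ℂ) (P : Matrix (Fin n) (Fin n) (Module.End ℂ (Fld l n α)))
    (i j : Fin n) (a : Fld l n α) : conjEta l n α β P i j a =
      etaFld l n α β (P i j ((etaFld l n α β).symm a)) := rfl

theorem conjEta_T (β : ℂ) : conjEta l n α β (Matrix.scalar (Fin n) (Fld.T l n α)) =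
    Matrix.scalar (Fin n) (Fld.T l n α) := by
  ext1 i j
  refine LinearMap.ext fun a => ?_
  rw [conjEta_apply]
  by_cases h : i = j
  · subst h
    simp [Matrix.scalar_apply, etaFld_T]
  · simp [Matrix.scalar_apply, h]

theorem conjEta_miuraFactor (β : ℂ) (s : Fin l) : conjEta l n α β (miuraFactor α s) =
    miuraFactor α s + β • Matrix.scalar (Fin n) (Fld.invZ l n α) := by
  ext1 i j
  refine LinearMap.ext fun a => ?_
  rw [conjEta_apply]
  change etaFld l n α β (Fld.nthProd (-1) (Fld.cur α s (GlLie.E i j)) _) =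
    Fld.nthProd (-1) (Fld.cur α s (GlLie.E i j)) a +
      (β • Matrix.scalar (Fin n) (Fld.invZ l n α) i j) a
  rw [etaFld_nthProd, LinearEquiv.apply_symm_apply, etaFld_cur, Fld.nthProd_add_left,
    Fld.nthProd_smul_left, Fld.nthProd_invZ_vac]
  congr 1
  by_cases h : i = j
  · subst h
    simp [Matrix.scalar_apply]
  · simp [Matrix.scalar_apply, h]

theorem commute_invZ_miuraFactor (s : Fin l) :
    Commute (Matrix.scalar (Fin n) (Fld.invZ l n α)) (miuraFactor α s) := by
  change _ * _ = _ * _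
  ext1 i j
  simpa [Matrix.scalar_apply] using! (Fld.commute_invZ_nthMode (Fld.cur α s (GlLie.E i j)) (-1)).eq

theorem wField_zero (i j : Fin n) :
    wField l n α 0 i j = (if i = j then 1 else 0 : ℂ) • Fld.vac l n α := by
  have h : ∀ (As : List (Matrix (Fin n) (Fin n) (Module.End ℂ (Fld l n α)))) P,
      As.foldl (miuraStep α) P 0 = P 0 := by
    intro As
    induction As with
    | nil => exact fun _ => rfl
    | cons A As ih => exact fun P => ih _
  rw [wField, miuraCoeff, h, Pi.single_eq_same]
  by_cases hij : i = j
  · subst hij; simp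
  · simp [hij]

/-- The action of `η_β^{⊗ l}` on the generators of the W-algebra, with `W^{(0)} = 1`. -/
theorem etaFld_wField (β : ℂ) (r : ℕ) (i j : Fin n) :
    etaFld l n α β (wField l n α r i j) =
      ∑ x ∈ antidiagonal r, shiftCoeff α β (l - x.1) x.2 •
        (Fld.invZ l n α ^ x.2) (wField l n α x.1 i j) := by
  have h1 : etaFld l n α β (wField l n α r i j) =
      conjEta l n α β (miuraCoeff l n α r) i j (Fld.vac l n α) := by
    rw [conjEta_apply, wField, (LinearEquiv.symm_apply_eq _).mpr (etaFld_vac β).symm]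
  have h0 : (fun q => conjEta l n α β ((Pi.single 0 1 : ℕ → Matrix (Fin n) (Fin n) _) q)) =
      Pi.single 0 1 := by
    funext q
    cases q <;> simp
  have h2 : ((List.finRange l).map (miuraFactor (n := n) α)).map (conjEta l n α β) =
      ((List.finRange l).map (miuraFactor α)).map
        (· + β • Matrix.scalar (Fin n) (Fld.invZ l n α)) := by
    simp [conjEta_miuraFactor]
  have hTM : Matrix.scalar (Fin n) (Fld.T l n α) * Matrix.scalar (Fin n) (Fld.invZ l n α) =
      Matrix.scalar (Fin n) (Fld.invZ l n α) * Matrix.scalar (Fin n) (Fld.T l n α) -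
      Matrix.scalar (Fin n) (Fld.invZ l n α) * Matrix.scalar (Fin n) (Fld.invZ l n α) := by
    rw [← map_mul, Fld.T_mul_invZ, ← map_mul, ← map_mul]
    exact map_sub (Matrix.scalar (Fin n) : Module.End ℂ (Fld l n α) →+* _) _ _
  have h3 : conjEta l n α β (miuraCoeff l n α r) = ∑ x ∈ antidiagonal r,
      shiftCoeff α β (l - x.1) x.2 •
        (Matrix.scalar (Fin n) (Fld.invZ l n α) ^ x.2 * miuraCoeff l n α x.1) := by
    have h4 := map_foldl_ringMiuraStep
      (S := Matrix (Fin n) (Fin n) (Module.End ℂ (Fld l n α))) (conjEta l n α β) α (Matrix.scalar (Fin n) (Fld.T l n α))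
      ((List.finRange l).map (miuraFactor α)) (Pi.single 0 1) r
    rw [miuraCoeff_eq]
    refine h4.trans ?_
    rw [conjEta_T, h0, h2,
      foldl_ringMiuraStep_add hTM α β _ (by
        intro A hA
        obtain ⟨s, -, rfl⟩ := List.mem_map.mp hA
        exact commute_invZ_miuraFactor s)]
    simp only [List.length_map, List.length_finRange]
  rw [h1, h3, Matrix.sum_apply, LinearMap.sum_apply]
  refine Finset.sum_congr rfl fun x _ => ?_
  rw [← map_pow, Matrix.smul_apply, LinearMap.smul_apply, Matrix.scalar_apply,
    Matrix.diagonal_mul]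
  rfl

/-! ### Current algebras -/

/-- The closed subalgebra of the completion generated by the Fourier coefficients of a set of
fields. -/
def coeffAlgebra (S : Set (Fld l n α)) : Subalgebra ℂ (UHat l n α) :=
  (Algebra.adjoin ℂ {x | ∃ a ∈ S, ∃ m : ℤ, x = (a : ℤ → UHat l n α) m}).topologicalClosure

theorem mem_coeffAlgebra {S : Set (Fld l n α)} {a : Fld l n α} (ha : a ∈ S) (m : ℤ) :
    (a : ℤ → UHat l n α) m ∈ coeffAlgebra S :=
  Subalgebra.le_topologicalClosure _ (Algebra.subset_adjoin ⟨a, ha, m, rfl⟩)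

theorem coeffAlgebra_le {S : Set (Fld l n α)} {C : Subalgebra ℂ (UHat l n α)}
    (hC : IsClosed (C : Set (UHat l n α))) (h : ∀ a ∈ S, ∀ m, (a : ℤ → UHat l n α) m ∈ C) :
    coeffAlgebra S ≤ C := by
  refine Subalgebra.topologicalClosure_minimal (Algebra.adjoin_le ?_) hC
  rintro _ ⟨a, ha, m, rfl⟩
  exact h a ha m

/-- The fields all of whose Fourier coefficients lie in a given subalgebra. -/
def fieldsIn (C : Subalgebra ℂ (UHat l n α)) : Submodule ℂ (Fld l n α) where
  carrier := {a | ∀ m, (a : ℤ → UHat l n α) m ∈ C}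
  zero_mem' _ := zero_mem C
  add_mem' ha hb m := add_mem (ha m) (hb m)
  smul_mem' c _ ha m := C.smul_mem (ha m) c

theorem isVertexSubalgebra_fieldsIn {C : Subalgebra ℂ (UHat l n α)}
    (hC : IsClosed (C : Set (UHat l n α))) : IsVertexSubalgebra (fieldsIn C) where
  vac_mem m := by
    change (if m = -1 then 1 else 0) ∈ C
    split_ifs
    exacts [one_mem C, zero_mem C]
  nthProd_mem a ha b hb k m := by
    refine hC.mem_of_tendsto (Fld.summable_nthTerm k a b m).hasSum
      (Filter.Eventually.of_forall fun t => sum_mem fun j _ => ?_)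
    exact C.smul_mem (sub_mem (mul_mem (ha _) (hb _)) (C.smul_mem (mul_mem (hb _) (ha _)) _)) _

/-- The Fourier coefficients of a generating set already generate the current algebra, since the fields
with coefficients in a closed subalgebra form a vertex subalgebra. -/
theorem coeffAlgebra_vertexSpan (S : Set (Fld l n α)) :
    coeffAlgebra (vertexSpan S : Set (Fld l n α)) = coeffAlgebra S := by
  refine le_antisymm (coeffAlgebra_le (Subalgebra.isClosed_topologicalClosure _) ?_)
    (coeffAlgebra_le (Subalgebra.isClosed_topologicalClosure _) fun a ha m => mem_coeffAlgebra ?_ m)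
  · intro a ha m
    have h : vertexSpan S ≤ fieldsIn (coeffAlgebra S) :=
      sInf_le ⟨isVertexSubalgebra_fieldsIn (Subalgebra.isClosed_topologicalClosure _),
        fun b hb => mem_coeffAlgebra hb⟩
    exact h ha m
  · exact Submodule.mem_sInf.mpr fun V hV => hV.2 ha

theorem etaFld_wField_mem (β : ℂ) {r : ℕ} (hr : r ≤ l) (i j : Fin n) :
    etaFld l n α β (wField l n α r i j) ∈
      fieldsIn (coeffAlgebra (WAlgebra l n α : Set (Fld l n α))) := by
  set C := coeffAlgebra (WAlgebra l n α : Set (Fld l n α)) with hCdef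
  have hvac : Fld.vac l n α ∈ fieldsIn C :=
    (isVertexSubalgebra_fieldsIn (Subalgebra.isClosed_topologicalClosure _)).vac_mem
  have hw : ∀ q ≤ r, wField l n α q i j ∈ fieldsIn C := by
    intro q hq
    rcases Nat.eq_zero_or_pos q with rfl | hq0
    · rw [wField_zero]
      exact Submodule.smul_mem _ _ hvac
    · rw [hCdef, WAlgebra, coeffAlgebra_vertexSpan]
      exact mem_coeffAlgebra ⟨q, i, j, hq0, hq.trans hr, rfl⟩
  rw [etaFld_wField]
  refine sum_mem fun x hx => Submodule.smul_mem _ _ fun m => ?_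
  rw [Fld.invZ_pow_apply]
  exact hw _ (by have := mem_antidiagonal.mp hx; lia) _

theorem eta_mem_coeffAlgebra (β : ℂ) {x : UHat l n α}
    (hx : x ∈ coeffAlgebra (WAlgebra l n α : Set (Fld l n α))) :
    UHat.eta l n α β x ∈ coeffAlgebra (WAlgebra l n α : Set (Fld l n α)) := by
  have hle : coeffAlgebra (WAlgebra l n α : Set (Fld l n α)) ≤
      (coeffAlgebra (WAlgebra l n α : Set (Fld l n α))).comap (UHat.eta l n α β).toAlgHom := by
    conv_lhs => rw [WAlgebra, coeffAlgebra_vertexSpan]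
    refine coeffAlgebra_le ?_ ?_
    · exact (Subalgebra.isClosed_topologicalClosure _).preimage (UHat.eta_continuous l n α β)
    · rintro _ ⟨r, i, j, -, hr, rfl⟩ m
      exact etaFld_wField_mem β hr i j m
  exact hle hx

end RectangularW

end

theorem lemma10p1 (l n : ℕ) (hl : 1 ≤ l) (hn : 3 ≤ n) (k β : ℂ) :
    (RectangularW.currentAlgebra (RectangularW.WAlgebra l n (RectangularW.level l n k))).map
        (RectangularW.UComp.eta l n (RectangularW.level l n k) β).toAlgHom =
      RectangularW.currentAlgebra (RectangularW.WAlgebra l n (RectangularW.level l n k)) := by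
  generalize RectangularW.level l n k = α
  apply le_antisymm
  · rintro _ ⟨x, hx, rfl⟩
    exact RectangularW.eta_mem_coeffAlgebra β hx
  · intro x hx
    refine ⟨(RectangularW.UComp.eta l n α β).symm x, ?_,
      (RectangularW.UComp.eta l n α β).apply_symm_apply x⟩
    exact RectangularW.eta_mem_coeffAlgebra (-β) hx
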